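/- **Setting.** Let $(M,d)$ be a complete metric space, $1\le p<\infty$, and let $\mathcal P^p(M)$ be the set of Borel probability measures $\mu$ on $M$ with full support (that is, $\mu(\operatorname{supp}\mu)=1$) and $\int_M d(x,y)^p\,d\mu(y)<\infty$ for some $x\in M$, with the $p$-Wasserstein distance $d_p^W(\mu,\nu)=\bigl[\inf_\pi\int_{M\times M}d(x,y)^p\,d\pi(x,y)\bigr]^{1/p}$, the infimum being over all couplings $\pi$ of $\mu$ and $\nu$. Let $\beta:\mathcal P^p(M)\to M$ be a $p$-contractive barycentric map: $\beta(\delta_x)=x$ for all $x\in M$, and $d(\beta(\mu),\beta(\nu))\le d_p^W(\mu,\nu)$ for all $\mu,\nu\in\mathcal P^p(M)$. Let $(\Omega,\mathcal A)$ be a standard Borel space, $\mathbf P$ a probability measure on it, $\mathcal B_1\subset\mathcal B_2\subset\cdots$ an increasing sequence of sub-$\sigma$-algebras of $\mathcal A$, and $\mathcal B_\infty$ the $\sigma$-algebra generated by $\bigcup_n\mathcal B_n$. For a sub-$\sigma$-algebra $\mathcal B\subset\mathcal A$, $L^p(\Omega,\mathcal B,\mathbf P;M)$ is the set of (classes modulo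 a.e. equality of) $\mathcal B$-strongly measurable functions $\varphi:\Omega\to M$ with $\int_\Omega d(x,\varphi)^p\,d\mathbf P<\infty$ for some $x\in M$; write $L^p(\Omega;M)$ when $\mathcal B=\mathcal A$, and $\mathbf d_p(\varphi,\psi)=\bigl[\int_\Omega d(\varphi,\psi)^p\,d\mathbf P\bigr]^{1/p}$. If $(\mathbf P_\omega)_{\omega\in\Omega}$ is the disintegration (regular conditional probability) of $\mathbf P$ with respect to $\mathcal B$, the $\beta$-conditional expectation of $\varphi\in L^p(\Omega;M)$ is $E^\beta_{\mathcal B}(\varphi)(\omega)=\beta(\varphi_*\mathbf P_\omega)$ for a.e. $\omega$. The filtered $\beta$-conditional expectation is $$E^\beta\bigl[\varphi\|(\mathcal B_n)_{n\ge k}\bigr]=\lim_{m\to\infty}E^\beta_{\mathcal B_k}\circ E^\beta_{\mathcal B_{k+1}}\circ\cdots\circ E^\beta_{\mathcal B_m}(\varphi)\in L^p(\Omega,\mathcal B_k,\mathbf P;M)\qquad(\text{limit in }\mathbf d_p).$$ A sequence $(\varphi_k)_{k\ge1}$ is a filtered $\beta$-martingale with respect to $(\mathcal B_n)$ if $\varphi_k\in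 L^p(\Omega,\mathcal B_k,\mathbf P;M)$ and $E^\beta\bigl[\varphi_{k+1}\|(\mathcal B_n)_{n\ge k}\bigr]=\varphi_k$ for all $k\ge1$. **Theorem.** Let $(\varphi_k)_{k\ge1}$ be a filtered $\beta$-martingale with respect to $(\mathcal B_n)_{n\ge1}$. Then the following are equivalent: (i) there exists $\varphi\in L^p(\Omega;M)$ such that $\varphi_k=E^\beta\bigl[\varphi\|(\mathcal B_n)_{n\ge k}\bigr]$ for all $k\ge1$; (ii) there exists $\varphi_\infty\in L^p(\Omega,\mathcal B_\infty,\mathbf P;M)$ such that $\mathbf d_p(\varphi_k,\varphi_\infty)\to0$ as $k\to\infty$. -/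

import Mathlib

open MeasureTheory ProbabilityTheory Filter Topology
open scoped ENNReal

namespace BetaMartingale

section Wasserstein

variable {M : Type*} [MetricSpace M] [MeasurableSpace M]

/-- `μ` belongs to `𝒫ᵖ(M)`: it is a Borel probability measure with full support (its support
has measure one) and it has a finite `p`-th moment about some point. -/
def IsWassersteinMeasure (p : ℝ) (μ : Measure M) : Prop :=
  IsProbabilityMeasure μ ∧ μ μ.supportᶜ = 0 ∧ ∃ x : M, ∫⁻ y, edist x y ^ p ∂μ < ∞

variable (M) in
/-- The set `𝒫ᵖ(M)` as a type. -/
abbrev WassersteinSpace (p : ℝ) : Type _ := {μ : Measure M // IsWassersteinMeasure p μ}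

/-- `π` is a coupling of `μ` and `ν`. As measures in `𝒫ᵖ(M)` live on separable closed sets, it
makes no difference whether a coupling is defined on the product `σ`-algebra (as here) or on the
Borel `σ`-algebra of `M × M`: on products of separable sets the two coincide. -/
def IsCoupling (μ ν : Measure M) (π : Measure (M × M)) : Prop :=
  π.map Prod.fst = μ ∧ π.map Prod.snd = ν

/-- The `p`-Wasserstein distance `d_p^W`. -/
noncomputable def wassersteinDist (p : ℝ) (μ ν : Measure M) : ℝ≥0∞ :=
  (⨅ (π : Measure (M × M)) (_ : IsCoupling μ ν π), ∫⁻ z, edist z.1 z.2 ^ p ∂π) ^ (1 / p)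

/-- `β : 𝒫ᵖ(M) → M` is a `p`-contractive barycentric map: `β(δ_x) = x` for all `x`, and
`d(β(μ), β(ν)) ≤ d_p^W(μ, ν)` for all `μ, ν ∈ 𝒫ᵖ(M)`. -/
def IsContractiveBarycentricMap (p : ℝ) (β : WassersteinSpace M p → M) : Prop :=
  (∀ (x : M) (μ : WassersteinSpace M p), μ.1 = Measure.dirac x → β μ = x) ∧
  ∀ μ ν : WassersteinSpace M p, edist (β μ) (β ν) ≤ wassersteinDist p μ.1 ν.1

/-- Point masses belong to `𝒫ᵖ(M)`, so the first condition above speaks about every `x`. -/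
theorem isWassersteinMeasure_dirac [BorelSpace M] {p : ℝ} (hp : 0 < p) (x : M) :
    IsWassersteinMeasure p (Measure.dirac x) := by
  refine ⟨inferInstance, ?_, x, ?_⟩
  · have hx : x ∈ (Measure.dirac x).support := by
      rw [Measure.mem_support_iff_forall]
      intro U hU
      exact lt_of_lt_of_le (by simp [mem_of_mem_nhds hU]) Measure.le_dirac_apply
    rw [Measure.dirac_apply' _ Measure.isOpen_compl_support.measurableSet]
    simp [hx]
  · rw [lintegral_dirac' _ (by fun_prop)]
    simp [hp]

end Wasserstein

section Lp

variable {Ω M : Type*} {mΩ : MeasurableSpace Ω} [MetricSpace M]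

/-- `φ ∈ Lᵖ(Ω, ℬ, P; M)`: `φ` is (`P`-a.e. equal to) a `ℬ`-strongly measurable function, and
`∫ d(x, φ)ᵖ dP < ∞` for some `x ∈ M`. Elements of `Lᵖ` are represented by functions, to be
identified when they agree almost everywhere. -/
def MemLpOn (p : ℝ) (P : Measure Ω) (ℬ : MeasurableSpace Ω) (φ : Ω → M) : Prop :=
  AEStronglyMeasurable[ℬ] φ P ∧ ∃ x : M, ∫⁻ ω, edist x (φ ω) ^ p ∂P < ∞

/-- The `Lᵖ`-distance `𝐝_p(φ, ψ)`. -/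
noncomputable def lpDist (p : ℝ) (P : Measure Ω) (φ ψ : Ω → M) : ℝ≥0∞ :=
  (∫⁻ ω, edist (φ ω) (ψ ω) ^ p ∂P) ^ (1 / p)

end Lp

section Conditional

open Classical in
/-- The `β`-conditional expectation `E_ℬ^β(φ)(ω) = β(φ_* P_ω)`, where `(P_ω)` is the
disintegration of `P` with respect to `ℬ` (Mathlib's `condExpKernel`). For `φ ∈ Lᵖ` the measure
`φ_* P_ω` lies in `𝒫ᵖ(M)` for almost every `ω`; on the exceptional null set the value is
irrelevant. -/
noncomputable def condExpβ {Ω M : Type*} (ℬ : MeasurableSpace Ω) {mΩ : MeasurableSpace Ω}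
    [StandardBorelSpace Ω] [MetricSpace M] [MeasurableSpace M] {p : ℝ}
    (β : WassersteinSpace M p → M) (P : Measure Ω) [IsFiniteMeasure P] (φ : Ω → M) :
    Ω → M := fun ω ↦
  if h : IsWassersteinMeasure p ((condExpKernel P ℬ ω).map φ) then
    β ⟨(condExpKernel P ℬ ω).map φ, h⟩
  else φ ω

variable {Ω M : Type*} {mΩ : MeasurableSpace Ω} [StandardBorelSpace Ω]
  [MetricSpace M] [MeasurableSpace M]

/-- The iterated conditional expectation
`E^β[φ ‖ (ℬ_n)_{k+j ≥ n ≥ k}] = E_{ℬ_k}^β ∘ E_{ℬ_{k+1}}^β ∘ ⋯ ∘ E_{ℬ_{k+j}}^β (φ)`. -/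
noncomputable def iteratedCondExpβ {p : ℝ} (β : WassersteinSpace M p → M) (P : Measure Ω)
    [IsFiniteMeasure P] (ℬ : ℕ → MeasurableSpace Ω) (φ : Ω → M) : ℕ → ℕ → Ω → M
  | k, 0 => condExpβ (ℬ k) β P φ
  | k, j + 1 => condExpβ (ℬ k) β P (iteratedCondExpβ β P ℬ φ (k + 1) j)

/-- `ψ` is (a version of) the filtered `β`-conditional expectation `E^β[φ ‖ (ℬ_n)_{n ≥ k}]`, i.e.
`ψ ∈ Lᵖ(Ω, ℬ_k, P; M)` and `ψ` is the `𝐝_p`-limit of `E^β[φ ‖ (ℬ_n)_{m ≥ n ≥ k}]` as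
`m → ∞`. (Such a `ψ` is unique up to almost everywhere equality.) -/
def IsFilteredCondExp {p : ℝ} (β : WassersteinSpace M p → M) (P : Measure Ω)
    [IsFiniteMeasure P] (ℬ : ℕ → MeasurableSpace Ω) (k : ℕ) (φ ψ : Ω → M) : Prop :=
  MemLpOn p P (ℬ k) ψ ∧
    Tendsto (fun j ↦ lpDist p P (iteratedCondExpβ β P ℬ φ k j) ψ) atTop (𝓝 0)

/-- `(φ_k)` is a filtered `β`-martingale with respect to `(ℬ_n)`: `φ_k ∈ Lᵖ(Ω, ℬ_k, P; M)` and
`E^β[φ_{k+1} ‖ (ℬ_n)_{n ≥ k}] = φ_k` for every `k`. -/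
def IsFilteredMartingale {p : ℝ} (β : WassersteinSpace M p → M) (P : Measure Ω)
    [IsFiniteMeasure P] (ℬ : ℕ → MeasurableSpace Ω) (φ : ℕ → Ω → M) : Prop :=
  (∀ k, MemLpOn p P (ℬ k) (φ k)) ∧ ∀ k, IsFilteredCondExp β P ℬ k (φ (k + 1)) (φ k)

end Conditional

end BetaMartingale

/-
Each `β`-conditional expectation is a `𝐝_p`-contraction of `Lᵖ` fixing the functions measurable
for the conditioning `σ`-algebra. Lévy's upward theorem `E_{ℬ_n}^β ψ → E_{ℬ_∞}^β ψ` holds for a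
simple function `s` because `E_ℬ^β s` is a continuous function of the conditional probabilities
of the level sets of `s` (transport only the mass in which two discrete laws differ), to which the
scalar Lévy theorem applies; contractivity and density of simple functions give the general case.
If `φ_k` is the filtered conditional expectation of `ψ`, then for every `f ∈ Lᵖ(ℬ_k)` the
contractions yield `𝐝_p(φ_k, f) ≤ 𝐝_p(E_{ℬ_∞}^β ψ, f)`; taking `f = E_{ℬ_k}^β ψ` shows that
`φ_k → E_{ℬ_∞}^β ψ`. Conversely, `φ_k = E_{ℬ_k}^β ⋯ E_{ℬ_{k+j}}^β φ_{k+j+1}` along a filtered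
martingale, and this differs from `E_{ℬ_k}^β ⋯ E_{ℬ_{k+j}}^β φ_∞` by at most
`𝐝_p(φ_{k+j+1}, φ_∞)`.
-/

namespace BetaMartingale

section Coupling

theorem exists_map_fst_eq_and_map_snd_eq {X Y : Type*} [MeasurableSpace X] [MeasurableSpace Y]
    {ρ : Measure X} {σ : Measure Y} [IsFiniteMeasure ρ] [IsFiniteMeasure σ]
    (h : ρ Set.univ = σ Set.univ) :
    ∃ π : Measure (X × Y), π.map Prod.fst = ρ ∧ π.map Prod.snd = σ := by
  rcases eq_or_ne (ρ Set.univ) 0 with h0 | h0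
  · have hρ : ρ = 0 := Measure.measure_univ_eq_zero.1 h0
    have hσ : σ = 0 := Measure.measure_univ_eq_zero.1 (h ▸ h0)
    exact ⟨0, by simp [hρ], by simp [hσ]⟩
  · have hcancel : (ρ Set.univ)⁻¹ * ρ Set.univ = 1 :=
      ENNReal.inv_mul_cancel h0 (measure_ne_top ρ _)
    refine ⟨(ρ Set.univ)⁻¹ • ρ.prod σ, ?_, ?_⟩
    · rw [Measure.map_smul, Measure.map_fst_prod, ← h, smul_smul, hcancel, one_smul]
    · rw [Measure.map_smul, Measure.map_snd_prod, smul_smul, hcancel, one_smul]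

variable {M : Type*} [MetricSpace M] [MeasurableSpace M] {p : ℝ} {μ ν : Measure M}

theorem wassersteinDist_rpow_le_lintegral (hp : 0 < p) {π : Measure (M × M)}
    (hπ : IsCoupling μ ν π) : wassersteinDist p μ ν ^ p ≤ ∫⁻ z, edist z.1 z.2 ^ p ∂π := by
  rw [wassersteinDist, one_div, ENNReal.rpow_inv_rpow hp.ne']
  exact iInf₂_le π hπ

-- The mass common to `μ` and `ν` is left in place; only the rest has to be transported.
theorem wassersteinDist_rpow_le_of_common_minorant (hp : 0 < p) [IsFiniteMeasure μ]
    [IsFiniteMeasure ν] (hμν : μ Set.univ = ν Set.univ) {c : Measure M} (hcμ : c ≤ μ)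
    (hcν : c ≤ ν) {S : Set M} (hμS : ∀ᵐ x ∂μ, x ∈ S) (hνS : ∀ᵐ x ∂ν, x ∈ S) :
    wassersteinDist p μ ν ^ p ≤ Metric.ediam S ^ p * (μ Set.univ - c Set.univ) := by
  have : IsFiniteMeasure c := isFiniteMeasure_of_le μ hcμ
  have hmass : (μ - c) Set.univ = (ν - c) Set.univ := by
    rw [Measure.sub_apply .univ hcμ, Measure.sub_apply .univ hcν, hμν]
  obtain ⟨π, hπμ, hπν⟩ := exists_map_fst_eq_and_map_snd_eq hmass
  have hcoupling : IsCoupling μ ν (π + c.map fun x ↦ (x, x)) := by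
    constructor
    · rw [Measure.map_add _ _ measurable_fst, hπμ, Measure.map_map measurable_fst (by fun_prop)]
      exact (congrArg _ Measure.map_id).trans (Measure.sub_add_cancel_of_le hcμ)
    · rw [Measure.map_add _ _ measurable_snd, hπν, Measure.map_map measurable_snd (by fun_prop)]
      exact (congrArg _ Measure.map_id).trans (Measure.sub_add_cancel_of_le hcν)
  have hdiag : ∫⁻ z, edist z.1 z.2 ^ p ∂c.map (fun x ↦ (x, x)) = 0 :=
    nonpos_iff_eq_zero.1 ((lintegral_map_le _ _).trans_eq (by simp [hp]))
  have hfst : ∀ᵐ z ∂π, z.1 ∈ S :=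
    ae_of_ae_map measurable_fst.aemeasurable (hπμ ▸ ae_mono Measure.sub_le hμS)
  have hsnd : ∀ᵐ z ∂π, z.2 ∈ S :=
    ae_of_ae_map measurable_snd.aemeasurable (hπν ▸ ae_mono Measure.sub_le hνS)
  calc wassersteinDist p μ ν ^ p
      ≤ ∫⁻ z, edist z.1 z.2 ^ p ∂(π + c.map fun x ↦ (x, x)) :=
        wassersteinDist_rpow_le_lintegral hp hcoupling
    _ = ∫⁻ z, edist z.1 z.2 ^ p ∂π := by rw [lintegral_add_measure, hdiag, add_zero]
    _ ≤ ∫⁻ _, Metric.ediam S ^ p ∂π := by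
        refine lintegral_mono_ae ?_
        filter_upwards [hfst, hsnd] with z hz₁ hz₂
        exact ENNReal.rpow_le_rpow (Metric.edist_le_ediam_of_mem hz₁ hz₂) hp.le
    _ = Metric.ediam S ^ p * (μ Set.univ - c Set.univ) := by
        rw [lintegral_const, ← Measure.sub_apply .univ hcμ, ← hπμ,
          Measure.map_apply measurable_fst .univ, Set.preimage_univ]

end Coupling

section WassersteinMeasure

variable {M : Type*} [MetricSpace M] [MeasurableSpace M] {p : ℝ} {μ : Measure M}

theorem measure_compl_support_eq_zero_of_isSeparable {S : Set M}
    (hS : TopologicalSpace.IsSeparable S) (hμ : ∀ᵐ x ∂μ, x ∈ S) : μ μ.supportᶜ = 0 := by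
  have hsep : TopologicalSpace.IsSeparable (μ.supportᶜ ∩ S) := hS.mono Set.inter_subset_right
  have := hsep.separableSpace
  have := UniformSpace.secondCountable_of_separable (μ.supportᶜ ∩ S : Set M)
  have hlindelof : IsLindelof (μ.supportᶜ ∩ S) := isLindelof_iff_lindelofSpace.2 inferInstance
  have hnull : (μ.supportᶜ ∩ S)ᶜ ∈ ae μ := by
    refine hlindelof.compl_mem_sets_of_nhdsWithin fun x hx ↦ ?_
    obtain ⟨U, hU, hU0⟩ := Measure.notMem_support_iff_exists.1 hx.1
    exact ⟨U, mem_nhdsWithin_of_mem_nhds hU, compl_mem_ae_iff.2 hU0⟩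
  refine mem_ae_iff.1 ?_
  filter_upwards [hnull, hμ] with x hx hxS
  by_contra hx'
  exact hx ⟨hx', hxS⟩

theorem isWassersteinMeasure_of_finite (hp : 0 ≤ p) [IsProbabilityMeasure μ] {S : Set M}
    (hS : S.Finite) (hμ : ∀ᵐ x ∂μ, x ∈ S) : IsWassersteinMeasure p μ := by
  obtain ⟨x, hx⟩ := hμ.exists
  refine ⟨inferInstance, measure_compl_support_eq_zero_of_isSeparable hS.isSeparable hμ, x, ?_⟩
  calc ∫⁻ y, edist x y ^ p ∂μ ≤ ∫⁻ _, Metric.ediam S ^ p ∂μ := by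
        refine lintegral_mono_ae ?_
        filter_upwards [hμ] with y hy
        exact ENNReal.rpow_le_rpow (Metric.edist_le_ediam_of_mem hx hy) hp
    _ < ∞ := by
        rw [lintegral_const, measure_univ, mul_one]
        exact ENNReal.rpow_lt_top_of_nonneg hp hS.isBounded.ediam_ne_top

end WassersteinMeasure

section DiscreteLaw

variable {F M : Type*} [Fintype F] [MeasurableSpace M]

/-- The law on `M` that gives the point `e x` the weight `w x`. -/
noncomputable def discreteLaw (e : F → M) (w : stdSimplex ℝ F) : Measure M :=
  ∑ x, ENNReal.ofReal (w x) • Measure.dirac (e x)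

theorem sum_ofReal_stdSimplex (w : stdSimplex ℝ F) : ∑ x, ENNReal.ofReal (w x) = 1 := by
  rw [← ENNReal.ofReal_sum_of_nonneg fun x _ ↦ stdSimplex.zero_le w x, stdSimplex.sum_eq_one,
    ENNReal.ofReal_one]

instance isProbabilityMeasure_discreteLaw (e : F → M) (w : stdSimplex ℝ F) :
    IsProbabilityMeasure (discreteLaw e w) :=
  ⟨by simpa [discreteLaw] using sum_ofReal_stdSimplex w⟩

variable [MetricSpace M] [BorelSpace M] {p : ℝ} {β : WassersteinSpace M p → M}

theorem ae_discreteLaw_mem_range (e : F → M) (w : stdSimplex ℝ F) :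
    ∀ᵐ y ∂discreteLaw e w, y ∈ Set.range e := by
  have hmeas : MeasurableSet (Set.range e)ᶜ := (Set.finite_range e).measurableSet.compl
  refine mem_ae_iff.2 ?_
  change discreteLaw e w (Set.range e)ᶜ = 0
  simp [discreteLaw, Measure.dirac_apply' _ hmeas]

theorem isWassersteinMeasure_discreteLaw (hp : 0 ≤ p) (e : F → M) (w : stdSimplex ℝ F) :
    IsWassersteinMeasure p (discreteLaw e w) :=
  isWassersteinMeasure_of_finite hp (Set.finite_range e) (ae_discreteLaw_mem_range e w)

/-- The `β`-barycenter of the points `e x` with weights `w x`. -/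
noncomputable def weightedBarycenter (hp : 0 ≤ p) (β : WassersteinSpace M p → M) (e : F → M)
    (w : stdSimplex ℝ F) : M :=
  β ⟨discreteLaw e w, isWassersteinMeasure_discreteLaw hp e w⟩

theorem wassersteinDist_discreteLaw_rpow_le (hp : 0 < p) (e : F → M) (v w : stdSimplex ℝ F) :
    wassersteinDist p (discreteLaw e v) (discreteLaw e w) ^ p ≤
      Metric.ediam (Set.range e) ^ p * (1 - ∑ x, ENNReal.ofReal (min (v x) (w x))) := by
  have hle : ∀ u : stdSimplex ℝ F, (∀ x, min (v x) (w x) ≤ u x) →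
      ∑ x, ENNReal.ofReal (min (v x) (w x)) • Measure.dirac (e x) ≤ discreteLaw e u :=
    fun u hu ↦ Finset.sum_le_sum fun x _ ↦ by gcongr; exact hu x
  simpa using wassersteinDist_rpow_le_of_common_minorant hp (by simp only [measure_univ])
    (hle v fun x ↦ min_le_left _ _) (hle w fun x ↦ min_le_right _ _)
    (ae_discreteLaw_mem_range e v) (ae_discreteLaw_mem_range e w)

theorem continuous_weightedBarycenter (hp : 0 < p) (hβ : IsContractiveBarycentricMap p β)
    (e : F → M) : Continuous (weightedBarycenter hp.le β e) := by
  refine continuous_iff_continuousAt.2 fun w ↦ tendsto_iff_edist_tendsto_0.2 ?_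
  set bound : stdSimplex ℝ F → ℝ≥0∞ := fun v ↦
    (Metric.ediam (Set.range e) ^ p * (1 - ∑ x, ENNReal.ofReal (min (v x) (w x)))) ^ p⁻¹
  have hfin : Metric.ediam (Set.range e) ^ p ≠ ∞ :=
    (ENNReal.rpow_lt_top_of_nonneg hp.le (Set.finite_range e).isBounded.ediam_ne_top).ne
  have hcont : Continuous bound := by
    refine ENNReal.continuous_rpow_const.comp ((ENNReal.continuous_const_mul hfin).comp
      ((ENNReal.continuous_sub_left ENNReal.one_ne_top).comp ?_))
    refine continuous_finsetSum _ fun x _ ↦ ENNReal.continuous_ofReal.comp ?_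
    exact ((continuous_apply x).comp continuous_subtype_val).min continuous_const
  have hlim : Tendsto bound (𝓝 w) (𝓝 0) := by
    simpa [bound, sum_ofReal_stdSimplex, hp] using hcont.tendsto w
  refine tendsto_of_tendsto_of_tendsto_of_le_of_le tendsto_const_nhds hlim (fun _ ↦ zero_le)
    fun v ↦ (hβ.2 _ _).trans ?_
  exact (ENNReal.le_rpow_inv_iff hp).2 (wassersteinDist_discreteLaw_rpow_le hp e v w)

end DiscreteLaw

section SimpleFunc

variable {Ω M : Type*} {mΩ : MeasurableSpace Ω}

/-- The law of a simple function under `κ`, as a point of the simplex over its range. -/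
noncomputable def simpleFuncWeights (s : SimpleFunc Ω M) (κ : Measure Ω)
    [IsProbabilityMeasure κ] : stdSimplex ℝ s.range :=
  ⟨fun x ↦ κ.real (s ⁻¹' {x.1}), fun _ ↦ measureReal_nonneg, by
    rw [s.range.sum_coe_sort fun x ↦ κ.real (s ⁻¹' {x}),
      ← measureReal_biUnion_finset (fun x _ y _ hxy ↦ Disjoint.preimage _ (by simpa using hxy))
        fun x _ ↦ s.measurableSet_preimage _]
    convert probReal_univ (μ := κ)
    ext ω
    simp⟩

theorem measurable_simpleFuncWeights {Y : Type*} {_ : MeasurableSpace Y} (s : SimpleFunc Ω M)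
    (η : Kernel Y Ω) [IsMarkovKernel η] : Measurable fun y ↦ simpleFuncWeights s (η y) :=
  Measurable.subtype_mk (measurable_pi_iff.2 fun _ ↦
    (η.measurable_coe (s.measurableSet_preimage _)).ennreal_toReal)

theorem map_simpleFunc_eq_discreteLaw [MeasurableSpace M] {s : SimpleFunc Ω M}
    (hs : Measurable s) (κ : Measure Ω) [IsProbabilityMeasure κ] :
    κ.map s = discreteLaw Subtype.val (simpleFuncWeights s κ) := by
  ext A hA
  have hind : κ (s ⁻¹' A) = ∫⁻ ω, s.map (A.indicator fun _ ↦ (1 : ℝ≥0∞)) ω ∂κ := by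
    rw [← lintegral_indicator_one (hs hA)]
    rfl
  rw [Measure.map_apply hs hA, hind, SimpleFunc.lintegral_eq_lintegral, SimpleFunc.map_lintegral,
    discreteLaw, Measure.finsetSum_apply, ← s.range.sum_coe_sort]
  refine Finset.sum_congr rfl fun x _ ↦ ?_
  rw [Measure.smul_apply, Measure.dirac_apply' _ hA, smul_eq_mul, mul_comm]
  congr 1
  exact (ofReal_measureReal).symm

end SimpleFunc

section LpDist

theorem edist_rpow_le {X : Type*} [PseudoEMetricSpace X] {p : ℝ} (hp : 0 ≤ p) (x y z : X) :
    edist x z ^ p ≤ 2 ^ p * (edist x y ^ p + edist y z ^ p) := by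
  calc edist x z ^ p ≤ (2 * max (edist x y) (edist y z)) ^ p := by
        gcongr
        rw [two_mul]
        exact (edist_triangle x y z).trans (add_le_add (le_max_left _ _) (le_max_right _ _))
    _ = 2 ^ p * max (edist x y ^ p) (edist y z ^ p) := by
        rw [ENNReal.mul_rpow_of_nonneg _ _ hp, (ENNReal.monotone_rpow_of_nonneg hp).map_max]
    _ ≤ 2 ^ p * (edist x y ^ p + edist y z ^ p) := by
        gcongr
        exact max_le_add_of_nonneg zero_le zero_le

variable {Ω M : Type*} {ℬ ℬ' mΩ : MeasurableSpace Ω} [MetricSpace M] {p : ℝ} {P : Measure Ω}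
  {φ φ' ψ ψ' χ : Ω → M}

theorem lpDist_comm : lpDist p P φ ψ = lpDist p P ψ φ := by
  simp only [lpDist, edist_comm]

theorem lpDist_rpow (hp : 0 < p) : lpDist p P φ ψ ^ p = ∫⁻ ω, edist (φ ω) (ψ ω) ^ p ∂P := by
  rw [lpDist, one_div, ENNReal.rpow_inv_rpow hp.ne']

theorem lpDist_congr_ae (hφ : φ =ᵐ[P] φ') (hψ : ψ =ᵐ[P] ψ') :
    lpDist p P φ ψ = lpDist p P φ' ψ' := by
  refine congrArg (· ^ (1 / p)) (lintegral_congr_ae ?_)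
  filter_upwards [hφ, hψ] with ω hω hω'
  rw [hω, hω']

theorem lpDist_triangle (hp : 1 ≤ p) (hφ : AEStronglyMeasurable φ P)
    (hψ : AEStronglyMeasurable ψ P) (hχ : AEStronglyMeasurable χ P) :
    lpDist p P φ χ ≤ lpDist p P φ ψ + lpDist p P ψ χ := by
  refine le_trans ?_ (ENNReal.lintegral_Lp_add_le (hφ.edist hψ) (hψ.edist hχ) hp)
  have : 0 ≤ p := zero_le_one.trans hp
  unfold lpDist
  gcongr with ω
  exact edist_triangle _ _ _

theorem ae_eq_of_lpDist_eq_zero (hp : 0 < p) (hφ : AEStronglyMeasurable φ P)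
    (hψ : AEStronglyMeasurable ψ P) (h : lpDist p P φ ψ = 0) : φ =ᵐ[P] ψ := by
  have hint : ∫⁻ ω, edist (φ ω) (ψ ω) ^ p ∂P = 0 := by
    rw [← lpDist_rpow hp, h, ENNReal.zero_rpow_of_pos hp]
  filter_upwards [(lintegral_eq_zero_iff' ((hφ.edist hψ).pow_const p)).1 hint] with ω hω
  exact edist_eq_zero.1 ((ENNReal.rpow_eq_zero_iff_of_pos hp).1 hω)

theorem tendsto_lpDist_of_dominated_convergence (hp : 0 < p) {f : ℕ → Ω → M} {g : Ω → M}
    (bound : Ω → ℝ≥0∞) (hf : ∀ n, AEStronglyMeasurable (f n) P) (hg : AEStronglyMeasurable g P)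
    (hbound : ∀ n ω, edist (f n ω) (g ω) ≤ bound ω) (hfin : ∫⁻ ω, bound ω ^ p ∂P ≠ ∞)
    (hlim : ∀ᵐ ω ∂P, Tendsto (fun n ↦ f n ω) atTop (𝓝 (g ω))) :
    Tendsto (fun n ↦ lpDist p P (f n) g) atTop (𝓝 0) := by
  have hlim_rpow : ∀ᵐ ω ∂P, Tendsto (fun n ↦ edist (f n ω) (g ω) ^ p) atTop (𝓝 0) := by
    filter_upwards [hlim] with ω hω
    simpa [hp] using (tendsto_iff_edist_tendsto_0.1 hω).ennrpow_const p
  have hint : Tendsto (fun n ↦ ∫⁻ ω, edist (f n ω) (g ω) ^ p ∂P) atTop (𝓝 0) := by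
    simpa using tendsto_lintegral_of_dominated_convergence' (fun ω ↦ bound ω ^ p)
      (fun n ↦ ((hf n).edist hg).pow_const p)
      (fun n ↦ .of_forall fun ω ↦ ENNReal.rpow_le_rpow (hbound n ω) hp.le) hfin hlim_rpow
  simpa [lpDist, hp] using hint.ennrpow_const (1 / p)

theorem MemLpOn.mono (hφ : MemLpOn p P ℬ φ) (h : ℬ ≤ ℬ') : MemLpOn p P ℬ' φ :=
  ⟨hφ.1.mono h, hφ.2⟩

theorem MemLpOn.congr_ae (hφ : MemLpOn p P ℬ φ) (h : φ =ᵐ[P] ψ) : MemLpOn p P ℬ ψ := by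
  obtain ⟨hmeas, x, hx⟩ := hφ
  refine ⟨hmeas.congr h, x, ?_⟩
  exact (lintegral_congr_ae (h.mono fun ω hω ↦ by simp only [hω])).trans_lt hx

theorem MemLpOn.lintegral_edist_rpow_lt_top (hp : 0 ≤ p) [IsFiniteMeasure P]
    (hφ : MemLpOn p P ℬ φ) (x : M) : ∫⁻ ω, edist x (φ ω) ^ p ∂P < ∞ := by
  obtain ⟨-, y, hy⟩ := hφ
  have h2 : (2 : ℝ≥0∞) ^ p < ∞ := ENNReal.rpow_lt_top_of_nonneg hp (by simp)
  calc ∫⁻ ω, edist x (φ ω) ^ p ∂P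
      ≤ ∫⁻ ω, 2 ^ p * (edist x y ^ p + edist y (φ ω) ^ p) ∂P :=
        lintegral_mono fun ω ↦ edist_rpow_le hp x y (φ ω)
    _ = 2 ^ p * (edist x y ^ p * P Set.univ + ∫⁻ ω, edist y (φ ω) ^ p ∂P) := by
        rw [lintegral_const_mul' _ _ h2.ne, lintegral_add_left measurable_const, lintegral_const]
    _ < ∞ := ENNReal.mul_lt_top h2 (ENNReal.add_lt_top.2 ⟨ENNReal.mul_lt_top
        (ENNReal.rpow_lt_top_of_nonneg hp (edist_ne_top x y)) (measure_lt_top _ _), hy⟩)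

theorem memLpOn_const (hp : 0 < p) (x : M) : MemLpOn p P ℬ fun _ ↦ x :=
  ⟨aestronglyMeasurable_const, x, by simp [hp]⟩

theorem memLpOn_simpleFunc [Nonempty M] (hp : 0 ≤ p) [IsFiniteMeasure P] (s : SimpleFunc Ω M) :
    MemLpOn p P mΩ s := by
  obtain ⟨x⟩ := ‹Nonempty M›
  refine ⟨s.stronglyMeasurable.aestronglyMeasurable, x, ?_⟩
  calc ∫⁻ ω, edist x (s ω) ^ p ∂P ≤ ∫⁻ _, ∑ y ∈ s.range, edist x y ^ p ∂P :=
        lintegral_mono fun ω ↦ Finset.single_le_sum (f := fun y ↦ edist x y ^ p)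
          (fun _ _ ↦ zero_le) (s.mem_range_self ω)
    _ < ∞ := by
        rw [lintegral_const]
        exact ENNReal.mul_lt_top (ENNReal.sum_lt_top.2 fun y _ ↦
          ENNReal.rpow_lt_top_of_nonneg hp (edist_ne_top x y)) (measure_lt_top _ _)

variable [MeasurableSpace M]

theorem wassersteinDist_map_le_lpDist (hp : 0 ≤ p) (hφ : AEMeasurable φ P)
    (hψ : AEMeasurable ψ P) : wassersteinDist p (P.map φ) (P.map ψ) ≤ lpDist p P φ ψ := by
  have hφψ := hφ.prodMk hψ
  have hcoupling : IsCoupling (P.map φ) (P.map ψ) (P.map fun ω ↦ (φ ω, ψ ω)) :=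
    ⟨AEMeasurable.map_map_of_aemeasurable measurable_fst.aemeasurable hφψ,
      AEMeasurable.map_map_of_aemeasurable measurable_snd.aemeasurable hφψ⟩
  exact ENNReal.rpow_le_rpow ((iInf₂_le _ hcoupling).trans (lintegral_map_le _ _))
    (one_div_nonneg.2 hp)

variable [BorelSpace M]

theorem MemLpOn.isWassersteinMeasure_map [IsProbabilityMeasure P] (hφ : MemLpOn p P mΩ φ) :
    IsWassersteinMeasure p (P.map φ) := by
  obtain ⟨hmeas, x, hx⟩ := hφ
  obtain ⟨S, hS, hφS⟩ := hmeas.isSeparable_ae_range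
  have hmem : ∀ᵐ y ∂P.map φ, y ∈ closure S :=
    (ae_map_iff hmeas.aemeasurable isClosed_closure.measurableSet).2
      (hφS.mono fun _ h ↦ subset_closure h)
  exact ⟨Measure.isProbabilityMeasure_map hmeas.aemeasurable,
    measure_compl_support_eq_zero_of_isSeparable hS.closure hmem, x,
    (lintegral_map_le _ _).trans_lt hx⟩

theorem exists_simpleFunc_tendsto_lpDist [Nonempty M] (hp : 0 < p) (hφ : StronglyMeasurable φ) :
    ∃ s : ℕ → SimpleFunc Ω M, ∀ (κ : Measure Ω) [IsFiniteMeasure κ], MemLpOn p κ mΩ φ →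
      Tendsto (fun n ↦ lpDist p κ (s n) φ) atTop (𝓝 0) := by
  obtain ⟨x⟩ := ‹Nonempty M›
  have hS : TopologicalSpace.IsSeparable (Set.range φ ∪ {x}) :=
    hφ.isSeparable_range.union (Set.finite_singleton x).isSeparable
  have := hS.separableSpace
  have hx : x ∈ Set.range φ ∪ {x} := Or.inr rfl
  refine ⟨SimpleFunc.approxOn φ hφ.measurable _ x hx, fun κ _ hκ ↦ ?_⟩
  exact tendsto_lpDist_of_dominated_convergence hp (fun ω ↦ edist x (φ ω))
    (fun n ↦ (SimpleFunc.stronglyMeasurable _).aestronglyMeasurable) hκ.1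
    (fun n ω ↦ SimpleFunc.edist_approxOn_le hφ.measurable hx ω n)
    (hκ.lintegral_edist_rpow_lt_top hp.le x).ne
    (.of_forall fun ω ↦ SimpleFunc.tendsto_approxOn hφ.measurable hx
      (subset_closure (Or.inl ⟨ω, rfl⟩)))

end LpDist

section CondExpKernel

variable {Ω M : Type*} {ℬ mΩ : MeasurableSpace Ω} [StandardBorelSpace Ω]
  {P : Measure Ω} [IsFiniteMeasure P]

theorem ae_trim_ae_condExpKernel (hℬ : ℬ ≤ mΩ) {q : Ω → Prop} (h : ∀ᵐ ω ∂P, q ω) :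
    ∀ᵐ ω ∂P.trim hℬ, ∀ᵐ y ∂condExpKernel P ℬ ω, q y :=
  Measure.ae_ae_of_ae_comp (by rwa [condExpKernel_comp_trim hℬ])

theorem aemeasurable_lintegral_condExpKernel (hℬ : ℬ ≤ mΩ) {f : Ω → ℝ≥0∞}
    (hf : AEMeasurable f P) :
    AEMeasurable[ℬ] (fun ω ↦ ∫⁻ y, f y ∂condExpKernel P ℬ ω) (P.trim hℬ) :=
  ⟨_, hf.measurable_mk.lintegral_kernel,
    (ae_trim_ae_condExpKernel hℬ hf.ae_eq_mk).mono fun _ h ↦ lintegral_congr_ae h⟩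

theorem lintegral_trim_condExpKernel (hℬ : ℬ ≤ mΩ) {f : Ω → ℝ≥0∞} (hf : AEMeasurable f P) :
    ∫⁻ ω, ∫⁻ y, f y ∂condExpKernel P ℬ ω ∂P.trim hℬ = ∫⁻ ω, f ω ∂P := by
  conv_rhs => rw [← condExpKernel_comp_trim (μ := P) hℬ]
  rw [Measure.lintegral_bind (Kernel.aemeasurable _) (by rwa [condExpKernel_comp_trim hℬ])]

theorem lintegral_condExpKernel (hℬ : ℬ ≤ mΩ) {f : Ω → ℝ≥0∞} (hf : AEMeasurable f P) :
    ∫⁻ ω, ∫⁻ y, f y ∂condExpKernel P ℬ ω ∂P = ∫⁻ ω, f ω ∂P := by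
  rw [← lintegral_trim_ae hℬ (aemeasurable_lintegral_condExpKernel hℬ hf),
    lintegral_trim_condExpKernel hℬ hf]

variable [MetricSpace M] {p : ℝ} {φ : Ω → M}

theorem ae_ae_condExpKernel_eq (hℬ : ℬ ≤ mΩ) (hφ : AEStronglyMeasurable[ℬ] φ P) :
    ∀ᵐ ω ∂P, ∀ᵐ y ∂condExpKernel P ℬ ω, φ y = φ ω := by
  have hmk : StronglyMeasurable[ℬ] (hφ.mk φ) := hφ.stronglyMeasurable_mk
  have hset : MeasurableSet[ℬ.prod mΩ] {z : Ω × Ω | hφ.mk φ z.2 = hφ.mk φ z.1} :=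
    StronglyMeasurable.measurableSet_eq_fun ((hmk.mono hℬ).comp_measurable measurable_snd)
      (hmk.comp_measurable measurable_fst)
  have hdiag : Measurable[mΩ, ℬ.prod mΩ] (Function.diag : Ω → Ω × Ω) :=
    Measurable.prodMk (measurable_id'' hℬ) measurable_id
  have hprod : ∀ᵐ z ∂(P.trim hℬ ⊗ₘ condExpKernel P ℬ), hφ.mk φ z.2 = hφ.mk φ z.1 := by
    rw [compProd_trim_condExpKernel hℬ]
    exact (@ae_map_iff Ω (Ω × Ω) mΩ (ℬ.prod mΩ) _ _
      (@Measurable.aemeasurable _ _ mΩ (ℬ.prod mΩ) _ _ hdiag) _ hset).2 (.of_forall fun _ ↦ rfl)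
  filter_upwards [ae_of_ae_trim hℬ (Measure.ae_ae_of_ae_compProd hprod), hφ.ae_eq_mk,
    ae_of_ae_trim hℬ (ae_trim_ae_condExpKernel hℬ hφ.ae_eq_mk)] with ω hmk_eq hω hκ
  filter_upwards [hmk_eq, hκ] with y hy hy'
  rw [hy', hω, hy]

theorem ae_trim_memLpOn_condExpKernel (hℬ : ℬ ≤ mΩ) (hφ : MemLpOn p P mΩ φ) :
    ∀ᵐ ω ∂P.trim hℬ, MemLpOn p (condExpKernel P ℬ ω) mΩ φ := by
  obtain ⟨hmeas, x, hx⟩ := hφ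
  have hmoment := (aestronglyMeasurable_const (b := x).edist hmeas).pow_const p
  rw [← lintegral_trim_condExpKernel hℬ hmoment] at hx
  filter_upwards [ae_trim_ae_condExpKernel hℬ hmeas.ae_eq_mk,
    ae_lt_top' (aemeasurable_lintegral_condExpKernel hℬ hmoment) hx.ne] with ω hmk hfin
  exact ⟨⟨_, hmeas.stronglyMeasurable_mk, hmk⟩, x, hfin⟩

end CondExpKernel

section CondExp

variable {Ω M : Type*} {ℬ 𝒞 mΩ : MeasurableSpace Ω} [StandardBorelSpace Ω]
  [MetricSpace M] [MeasurableSpace M] {P : Measure Ω} [IsFiniteMeasure P]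
  {p : ℝ} {β : WassersteinSpace M p → M} {φ ψ : Ω → M}

theorem condExpβ_congr_ae (hℬ : ℬ ≤ mΩ) (h : φ =ᵐ[P] ψ) :
    condExpβ ℬ β P φ =ᵐ[P] condExpβ ℬ β P ψ := by
  filter_upwards [ae_of_ae_trim hℬ (ae_trim_ae_condExpKernel hℬ h), h] with ω hκ hω
  have hmap : (condExpKernel P ℬ ω).map φ = (condExpKernel P ℬ ω).map ψ := Measure.map_congr hκ
  by_cases hW : IsWassersteinMeasure p ((condExpKernel P ℬ ω).map φ)
  · rw [condExpβ, condExpβ, dif_pos hW, dif_pos (hmap ▸ hW)]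
    simp only [hmap]
  · rw [condExpβ, condExpβ, dif_neg hW, dif_neg (hmap ▸ hW), hω]

variable [BorelSpace M]

theorem condExpβ_ae_eq_self (hp : 0 < p) (hβ : IsContractiveBarycentricMap p β) (hℬ : ℬ ≤ mΩ)
    (hφ : AEStronglyMeasurable[ℬ] φ P) : condExpβ ℬ β P φ =ᵐ[P] φ := by
  filter_upwards [ae_ae_condExpKernel_eq hℬ hφ] with ω hω
  have hdirac : (condExpKernel P ℬ ω).map φ = Measure.dirac (φ ω) := by
    rw [Measure.map_congr hω, Measure.map_const, measure_univ, one_smul]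
  rw [condExpβ, dif_pos (hdirac ▸ isWassersteinMeasure_dirac hp (φ ω))]
  exact hβ.1 _ _ hdirac

theorem edist_condExpβ_le (hp : 0 ≤ p) (hβ : IsContractiveBarycentricMap p β) {ω : Ω}
    (hφ : MemLpOn p (condExpKernel P ℬ ω) mΩ φ) (hψ : MemLpOn p (condExpKernel P ℬ ω) mΩ ψ) :
    edist (condExpβ ℬ β P φ ω) (condExpβ ℬ β P ψ ω) ≤ lpDist p (condExpKernel P ℬ ω) φ ψ := by
  rw [condExpβ, condExpβ, dif_pos hφ.isWassersteinMeasure_map,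
    dif_pos hψ.isWassersteinMeasure_map]
  exact (hβ.2 _ _).trans
    (wassersteinDist_map_le_lpDist hp hφ.1.aemeasurable hψ.1.aemeasurable)

theorem lpDist_condExpβ_le (hp : 0 < p) (hβ : IsContractiveBarycentricMap p β) (hℬ : ℬ ≤ mΩ)
    (hφ : MemLpOn p P mΩ φ) (hψ : MemLpOn p P mΩ ψ) :
    lpDist p P (condExpβ ℬ β P φ) (condExpβ ℬ β P ψ) ≤ lpDist p P φ ψ := by
  rw [← ENNReal.rpow_le_rpow_iff hp, lpDist_rpow hp, lpDist_rpow hp,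
    ← lintegral_condExpKernel hℬ ((hφ.1.edist hψ.1).pow_const p)]
  refine lintegral_mono_ae ?_
  filter_upwards [ae_of_ae_trim hℬ (ae_trim_memLpOn_condExpKernel hℬ hφ),
    ae_of_ae_trim hℬ (ae_trim_memLpOn_condExpKernel hℬ hψ)] with ω hφω hψω
  rw [← lpDist_rpow hp]
  exact ENNReal.rpow_le_rpow (edist_condExpβ_le hp.le hβ hφω hψω) hp.le

theorem condExpβ_simpleFunc (hp : 0 ≤ p) (s : SimpleFunc Ω M) (ω : Ω) :
    condExpβ ℬ β P s ω =
      weightedBarycenter hp β Subtype.val (simpleFuncWeights s (condExpKernel P ℬ ω)) := by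
  have hlaw := map_simpleFunc_eq_discreteLaw s.measurable (condExpKernel P ℬ ω)
  rw [condExpβ, dif_pos (hlaw ▸ isWassersteinMeasure_discreteLaw hp _ _), weightedBarycenter]
  simp only [hlaw]

theorem stronglyMeasurable_condExpβ_simpleFunc (hp : 0 < p)
    (hβ : IsContractiveBarycentricMap p β) (s : SimpleFunc Ω M) :
    StronglyMeasurable[ℬ] (condExpβ ℬ β P s) := by
  rw [funext (condExpβ_simpleFunc hp.le s)]
  exact (continuous_weightedBarycenter hp hβ _).stronglyMeasurable.comp_measurable
    (measurable_simpleFuncWeights s (condExpKernel P ℬ))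

theorem aestronglyMeasurable_condExpβ (hp : 0 < p) (hβ : IsContractiveBarycentricMap p β)
    (hℬ : ℬ ≤ mΩ) (hφ : MemLpOn p P mΩ φ) : AEStronglyMeasurable[ℬ] (condExpβ ℬ β P φ) P := by
  have : Nonempty M := ⟨hφ.2.choose⟩
  have hmk := hφ.1.ae_eq_mk
  obtain ⟨s, hs⟩ := exists_simpleFunc_tendsto_lpDist hp hφ.1.stronglyMeasurable_mk
  have hlim : ∀ᵐ ω ∂P.trim hℬ,
      Tendsto (fun n ↦ condExpβ ℬ β P (s n) ω) atTop (𝓝 (condExpβ ℬ β P φ ω)) := by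
    filter_upwards [ae_trim_ae_condExpKernel hℬ hmk,
      ae_trim_memLpOn_condExpKernel hℬ hφ] with ω hmkω hφω
    refine tendsto_iff_edist_tendsto_0.2 (tendsto_of_tendsto_of_tendsto_of_le_of_le
      tendsto_const_nhds (hs _ (hφω.congr_ae hmkω)) (fun _ ↦ zero_le) fun n ↦ ?_)
    rw [← lpDist_congr_ae (φ := s n) .rfl hmkω]
    exact edist_condExpβ_le hp.le hβ (memLpOn_simpleFunc hp.le (s n)) hφω
  exact (aestronglyMeasurable_of_tendsto_ae atTop (fun n ↦
    (stronglyMeasurable_condExpβ_simpleFunc hp hβ (s n)).aestronglyMeasurable) hlim).of_trim hℬ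

theorem memLpOn_condExpβ (hp : 0 < p) (hβ : IsContractiveBarycentricMap p β)
    (hℬ : ℬ ≤ mΩ) (hφ : MemLpOn p P mΩ φ) : MemLpOn p P ℬ (condExpβ ℬ β P φ) := by
  obtain ⟨x, hx⟩ := hφ.2
  refine ⟨aestronglyMeasurable_condExpβ hp hβ hℬ hφ, x, ?_⟩
  have hconst : condExpβ ℬ β P (fun _ ↦ x) =ᵐ[P] fun _ ↦ x :=
    condExpβ_ae_eq_self hp hβ hℬ aestronglyMeasurable_const
  have hle := lpDist_condExpβ_le hp hβ hℬ (memLpOn_const hp x) hφ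
  rw [lpDist_congr_ae hconst .rfl, ← ENNReal.rpow_le_rpow_iff hp, lpDist_rpow hp,
    lpDist_rpow hp] at hle
  exact hle.trans_lt hx

theorem lpDist_condExpβ_condExpβ_le (hp : 1 ≤ p) (hβ : IsContractiveBarycentricMap p β)
    (hℬ : ℬ ≤ mΩ) (h𝒞 : 𝒞 ≤ mΩ) (hφ : MemLpOn p P mΩ φ) (hψ : MemLpOn p P mΩ ψ) :
    lpDist p P (condExpβ ℬ β P φ) (condExpβ 𝒞 β P φ) ≤
      lpDist p P φ ψ + (lpDist p P (condExpβ ℬ β P ψ) (condExpβ 𝒞 β P ψ) + lpDist p P φ ψ) := by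
  have hp0 : 0 < p := zero_lt_one.trans_le hp
  have hℬφ := (aestronglyMeasurable_condExpβ hp0 hβ hℬ hφ).mono hℬ
  have hℬψ := (aestronglyMeasurable_condExpβ hp0 hβ hℬ hψ).mono hℬ
  have h𝒞φ := (aestronglyMeasurable_condExpβ hp0 hβ h𝒞 hφ).mono h𝒞
  have h𝒞ψ := (aestronglyMeasurable_condExpβ hp0 hβ h𝒞 hψ).mono h𝒞
  calc lpDist p P (condExpβ ℬ β P φ) (condExpβ 𝒞 β P φ)
      ≤ lpDist p P (condExpβ ℬ β P φ) (condExpβ ℬ β P ψ) +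
          lpDist p P (condExpβ ℬ β P ψ) (condExpβ 𝒞 β P φ) := lpDist_triangle hp hℬφ hℬψ h𝒞φ
    _ ≤ lpDist p P (condExpβ ℬ β P φ) (condExpβ ℬ β P ψ) +
          (lpDist p P (condExpβ ℬ β P ψ) (condExpβ 𝒞 β P ψ) +
            lpDist p P (condExpβ 𝒞 β P ψ) (condExpβ 𝒞 β P φ)) := by
        gcongr
        exact lpDist_triangle hp hℬψ h𝒞ψ h𝒞φ
    _ ≤ _ := by
        gcongr
        · exact lpDist_condExpβ_le hp0 hβ hℬ hφ hψ
        · exact (lpDist_condExpβ_le hp0 hβ h𝒞 hψ hφ).trans_eq lpDist_comm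

end CondExp

variable {Ω M : Type*} {mΩ : MeasurableSpace Ω} [StandardBorelSpace Ω]
  [MetricSpace M] [MeasurableSpace M] [BorelSpace M] {P : Measure Ω} [IsFiniteMeasure P]
  {p : ℝ} {β : WassersteinSpace M p → M} {ℬ : ℕ → MeasurableSpace Ω}

section Levy

theorem ae_tendsto_condExpβ_simpleFunc (hp : 0 < p) (hβ : IsContractiveBarycentricMap p β)
    (hℬ : ∀ n, ℬ n ≤ mΩ) (hmono : Monotone ℬ) (s : SimpleFunc Ω M) :
    ∀ᵐ ω ∂P, Tendsto (fun n ↦ condExpβ (ℬ n) β P s ω) atTop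
      (𝓝 (condExpβ (⨆ n, ℬ n) β P s ω)) := by
  let ℱ : Filtration ℕ mΩ := ⟨ℬ, hmono, hℬ⟩
  have hweights : ∀ᵐ ω ∂P, ∀ x : s.range,
      Tendsto (fun n ↦ (condExpKernel P (ℬ n) ω).real (s ⁻¹' {x.1})) atTop
        (𝓝 ((condExpKernel P (⨆ n, ℬ n) ω).real (s ⁻¹' {x.1}))) := by
    refine ae_all_iff.2 fun x ↦ ?_
    have hs := s.measurableSet_preimage {x.1}
    filter_upwards [tendsto_ae_condExp (ℱ := ℱ) ((s ⁻¹' {x.1}).indicator fun _ ↦ (1 : ℝ)),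
      ae_all_iff.2 fun n ↦ condExpKernel_ae_eq_condExp (μ := P) (hℬ n) hs,
      condExpKernel_ae_eq_condExp (μ := P) (iSup_le hℬ) hs] with ω hlevy hn hsup
    rw [hsup]
    exact hlevy.congr fun n ↦ (hn n).symm
  filter_upwards [hweights] with ω hω
  simp only [condExpβ_simpleFunc hp.le]
  exact ((continuous_weightedBarycenter hp hβ _).tendsto _).comp
    (tendsto_subtype_rng.2 (tendsto_pi_nhds.2 hω))

theorem tendsto_lpDist_condExpβ_simpleFunc (hp : 0 < p) (hβ : IsContractiveBarycentricMap p β)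
    (hℬ : ∀ n, ℬ n ≤ mΩ) (hmono : Monotone ℬ) (s : SimpleFunc Ω M) :
    Tendsto (fun n ↦ lpDist p P (condExpβ (ℬ n) β P s) (condExpβ (⨆ n, ℬ n) β P s)) atTop
      (𝓝 0) := by
  set S : Set M := Set.range (weightedBarycenter hp.le β (Subtype.val : s.range → M))
  have hS : IsCompact S := isCompact_range (continuous_weightedBarycenter hp hβ _)
  have hmem : ∀ (𝒞 : MeasurableSpace Ω) (ω : Ω), condExpβ 𝒞 β P s ω ∈ S := fun 𝒞 ω ↦
    ⟨_, (condExpβ_simpleFunc hp.le s ω).symm⟩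
  have hmeas : ∀ 𝒞 ≤ mΩ, AEStronglyMeasurable (condExpβ 𝒞 β P s) P := fun 𝒞 h𝒞 ↦
    ((stronglyMeasurable_condExpβ_simpleFunc hp hβ s).mono h𝒞).aestronglyMeasurable
  refine tendsto_lpDist_of_dominated_convergence hp (fun _ ↦ Metric.ediam S)
    (fun n ↦ hmeas _ (hℬ n)) (hmeas _ (iSup_le hℬ))
    (fun n ω ↦ Metric.edist_le_ediam_of_mem (hmem _ ω) (hmem _ ω)) ?_
    (ae_tendsto_condExpβ_simpleFunc hp hβ hℬ hmono s)
  rw [lintegral_const]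
  exact ENNReal.mul_ne_top (ENNReal.rpow_lt_top_of_nonneg hp.le hS.isBounded.ediam_ne_top).ne
    (measure_ne_top _ _)

theorem tendsto_lpDist_condExpβ (hp : 1 ≤ p) (hβ : IsContractiveBarycentricMap p β)
    (hℬ : ∀ n, ℬ n ≤ mΩ) (hmono : Monotone ℬ) {φ : Ω → M} (hφ : MemLpOn p P mΩ φ) :
    Tendsto (fun n ↦ lpDist p P (condExpβ (ℬ n) β P φ) (condExpβ (⨆ n, ℬ n) β P φ)) atTop
      (𝓝 0) := by
  have hp0 : 0 < p := zero_lt_one.trans_le hp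
  have : Nonempty M := ⟨hφ.2.choose⟩
  have hmk := hφ.1.ae_eq_mk
  obtain ⟨s, hs⟩ := exists_simpleFunc_tendsto_lpDist hp0 hφ.1.stronglyMeasurable_mk
  have hsφ : Tendsto (fun j ↦ lpDist p P φ (s j)) atTop (𝓝 0) := by
    simpa only [lpDist_comm (φ := φ), lpDist_congr_ae .rfl hmk] using hs P (hφ.congr_ae hmk)
  refine ENNReal.tendsto_nhds_zero.2 fun ε hε ↦ ?_
  have hε3 : 0 < ε / 3 := ENNReal.div_pos hε.ne' (by simp)
  obtain ⟨j, hj⟩ := (ENNReal.tendsto_nhds_zero.1 hsφ (ε / 3) hε3).exists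
  filter_upwards [ENNReal.tendsto_nhds_zero.1
    (tendsto_lpDist_condExpβ_simpleFunc (P := P) hp0 hβ hℬ hmono (s j)) (ε / 3) hε3] with n hn
  calc lpDist p P (condExpβ (ℬ n) β P φ) (condExpβ (⨆ n, ℬ n) β P φ)
      ≤ lpDist p P φ (s j) +
          (lpDist p P (condExpβ (ℬ n) β P (s j)) (condExpβ (⨆ n, ℬ n) β P (s j)) +
            lpDist p P φ (s j)) :=
        lpDist_condExpβ_condExpβ_le hp hβ (hℬ n) (iSup_le hℬ) hφ (memLpOn_simpleFunc hp0.le (s j))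
    _ ≤ ε / 3 + (ε / 3 + ε / 3) := by gcongr
    _ = ε := by rw [← add_assoc, ENNReal.add_thirds]

end Levy

section Iterated

variable {φ ψ f : Ω → M} {k : ℕ}

theorem memLpOn_iteratedCondExpβ (hp : 0 < p) (hβ : IsContractiveBarycentricMap p β)
    (hℬ : ∀ n, ℬ n ≤ mΩ) (hφ : MemLpOn p P mΩ φ) (k j : ℕ) :
    MemLpOn p P (ℬ k) (iteratedCondExpβ β P ℬ φ k j) := by
  induction j generalizing k with
  | zero => exact memLpOn_condExpβ hp hβ (hℬ k) hφ
  | succ j ih => exact memLpOn_condExpβ hp hβ (hℬ k) ((ih (k + 1)).mono (hℬ _))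

theorem lpDist_iteratedCondExpβ_le (hp : 0 < p) (hβ : IsContractiveBarycentricMap p β)
    (hℬ : ∀ n, ℬ n ≤ mΩ) (hφ : MemLpOn p P mΩ φ) (hψ : MemLpOn p P mΩ ψ) (k j : ℕ) :
    lpDist p P (iteratedCondExpβ β P ℬ φ k j) (iteratedCondExpβ β P ℬ ψ k j) ≤
      lpDist p P φ ψ := by
  induction j generalizing k with
  | zero => exact lpDist_condExpβ_le hp hβ (hℬ k) hφ hψ
  | succ j ih =>
    have hmem : ∀ {χ : Ω → M}, MemLpOn p P mΩ χ →
        MemLpOn p P mΩ (iteratedCondExpβ β P ℬ χ (k + 1) j) :=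
      fun hχ ↦ (memLpOn_iteratedCondExpβ hp hβ hℬ hχ (k + 1) j).mono (hℬ _)
    exact (lpDist_condExpβ_le hp hβ (hℬ k) (hmem hφ) (hmem hψ)).trans (ih (k + 1))

theorem iteratedCondExpβ_ae_eq_self (hp : 0 < p) (hβ : IsContractiveBarycentricMap p β)
    (hℬ : ∀ n, ℬ n ≤ mΩ) (hmono : Monotone ℬ) (hf : AEStronglyMeasurable[ℬ k] f P) (j : ℕ) :
    iteratedCondExpβ β P ℬ f k j =ᵐ[P] f := by
  induction j generalizing k with
  | zero => exact condExpβ_ae_eq_self hp hβ (hℬ k) hf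
  | succ j ih =>
    exact (condExpβ_congr_ae (hℬ k) (ih (hf.mono (hmono k.le_succ)))).trans
      (condExpβ_ae_eq_self hp hβ (hℬ k) hf)

-- The outer conditional expectations fix `f`, so only the innermost one moves away from it.
theorem lpDist_iteratedCondExpβ_le_of_measurable (hp : 0 < p)
    (hβ : IsContractiveBarycentricMap p β) (hℬ : ∀ n, ℬ n ≤ mΩ) (hmono : Monotone ℬ)
    (hφ : MemLpOn p P mΩ φ) (hf : MemLpOn p P (ℬ k) f) (j : ℕ) :
    lpDist p P (iteratedCondExpβ β P ℬ φ k j) f ≤ lpDist p P (condExpβ (ℬ (k + j)) β P φ) f := by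
  induction j generalizing k with
  | zero => exact le_rfl
  | succ j ih =>
    have hmem := (memLpOn_iteratedCondExpβ hp hβ hℬ hφ (k + 1) j).mono (hℬ _)
    calc lpDist p P (iteratedCondExpβ β P ℬ φ k (j + 1)) f
        = lpDist p P (condExpβ (ℬ k) β P (iteratedCondExpβ β P ℬ φ (k + 1) j))
            (condExpβ (ℬ k) β P f) :=
          lpDist_congr_ae .rfl (condExpβ_ae_eq_self hp hβ (hℬ k) hf.1).symm
      _ ≤ lpDist p P (iteratedCondExpβ β P ℬ φ (k + 1) j) f :=
          lpDist_condExpβ_le hp hβ (hℬ k) hmem (hf.mono (hℬ k))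
      _ ≤ lpDist p P (condExpβ (ℬ (k + 1 + j)) β P φ) f := ih (hf.mono (hmono k.le_succ))
      _ = lpDist p P (condExpβ (ℬ (k + (j + 1))) β P φ) f := by rw [Nat.succ_add_eq_add_succ]

theorem IsFilteredCondExp.lpDist_le (hp : 1 ≤ p) (hβ : IsContractiveBarycentricMap p β)
    (hℬ : ∀ n, ℬ n ≤ mΩ) (hmono : Monotone ℬ) (hψ : MemLpOn p P mΩ ψ)
    (hφ : IsFilteredCondExp β P ℬ k ψ φ) (hf : MemLpOn p P (ℬ k) f) :
    lpDist p P φ f ≤ lpDist p P (condExpβ (⨆ n, ℬ n) β P ψ) f := by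
  have hp0 : 0 < p := zero_lt_one.trans_le hp
  have hmeas : ∀ 𝒞 ≤ mΩ, AEStronglyMeasurable (condExpβ 𝒞 β P ψ) P :=
    fun 𝒞 h𝒞 ↦ (aestronglyMeasurable_condExpβ hp0 hβ h𝒞 hψ).mono h𝒞
  have hfmeas : AEStronglyMeasurable f P := hf.1.mono (hℬ k)
  have hbound : ∀ j, lpDist p P φ f ≤ lpDist p P (iteratedCondExpβ β P ℬ ψ k j) φ +
      (lpDist p P (condExpβ (ℬ (k + j)) β P ψ) (condExpβ (⨆ n, ℬ n) β P ψ) +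
        lpDist p P (condExpβ (⨆ n, ℬ n) β P ψ) f) := fun j ↦
    calc lpDist p P φ f
        ≤ lpDist p P φ (iteratedCondExpβ β P ℬ ψ k j) +
            lpDist p P (iteratedCondExpβ β P ℬ ψ k j) f :=
          lpDist_triangle hp (hφ.1.1.mono (hℬ k))
            ((memLpOn_iteratedCondExpβ hp0 hβ hℬ hψ k j).1.mono (hℬ k)) hfmeas
      _ ≤ _ := by
          rw [lpDist_comm (φ := φ)]
          gcongr
          exact (lpDist_iteratedCondExpβ_le_of_measurable hp0 hβ hℬ hmono hψ hf j).trans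
            (lpDist_triangle hp (hmeas _ (hℬ _)) (hmeas _ (iSup_le hℬ)) hfmeas)
  have hlevy : Tendsto (fun j ↦ lpDist p P (condExpβ (ℬ (k + j)) β P ψ)
      (condExpβ (⨆ n, ℬ n) β P ψ)) atTop (𝓝 0) :=
    (tendsto_lpDist_condExpβ hp hβ hℬ hmono hψ).comp
      (tendsto_atTop_mono (Nat.le_add_left · k) tendsto_id)
  simpa using ge_of_tendsto' (hφ.2.add (hlevy.add_const _)) hbound

end Iterated

section Martingale

variable {φ : ℕ → Ω → M} {ψ : Ω → M}

theorem tendsto_lpDist_of_isFilteredCondExp (hp : 1 ≤ p) (hβ : IsContractiveBarycentricMap p β)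
    (hℬ : ∀ n, ℬ n ≤ mΩ) (hmono : Monotone ℬ) (hψ : MemLpOn p P mΩ ψ)
    (hφ : ∀ k, IsFilteredCondExp β P ℬ k ψ (φ k)) :
    Tendsto (fun k ↦ lpDist p P (φ k) (condExpβ (⨆ n, ℬ n) β P ψ)) atTop (𝓝 0) := by
  have hp0 : 0 < p := zero_lt_one.trans_le hp
  have hmeas : ∀ 𝒞 ≤ mΩ, AEStronglyMeasurable (condExpβ 𝒞 β P ψ) P :=
    fun 𝒞 h𝒞 ↦ (aestronglyMeasurable_condExpβ hp0 hβ h𝒞 hψ).mono h𝒞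
  have hlevy := tendsto_lpDist_condExpβ hp hβ hℬ hmono hψ
  refine tendsto_of_tendsto_of_tendsto_of_le_of_le tendsto_const_nhds
    (by simpa using hlevy.add hlevy) (fun _ ↦ zero_le) fun k ↦ ?_
  calc lpDist p P (φ k) (condExpβ (⨆ n, ℬ n) β P ψ)
      ≤ lpDist p P (φ k) (condExpβ (ℬ k) β P ψ) +
          lpDist p P (condExpβ (ℬ k) β P ψ) (condExpβ (⨆ n, ℬ n) β P ψ) :=
        lpDist_triangle hp ((hφ k).1.1.mono (hℬ k)) (hmeas _ (hℬ k)) (hmeas _ (iSup_le hℬ))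
    _ ≤ _ := by
        gcongr
        exact ((hφ k).lpDist_le hp hβ hℬ hmono hψ (memLpOn_condExpβ hp0 hβ (hℬ k) hψ)).trans_eq
          lpDist_comm

theorem IsFilteredMartingale.condExpβ_succ_ae_eq (hp : 0 < p)
    (hβ : IsContractiveBarycentricMap p β) (hℬ : ∀ n, ℬ n ≤ mΩ) (hmono : Monotone ℬ)
    (hφ : IsFilteredMartingale β P ℬ φ) (k : ℕ) :
    condExpβ (ℬ k) β P (φ (k + 1)) =ᵐ[P] φ k := by
  have hiter : ∀ j, iteratedCondExpβ β P ℬ (φ (k + 1)) k (j + 1) =ᵐ[P]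
      condExpβ (ℬ k) β P (φ (k + 1)) := fun j ↦
    condExpβ_congr_ae (hℬ k) (iteratedCondExpβ_ae_eq_self hp hβ hℬ hmono (hφ.1 (k + 1)).1 j)
  have hlim := (hφ.2 k).2.comp (tendsto_add_atTop_nat 1)
  simp only [Function.comp_def, lpDist_congr_ae (hiter _) .rfl] at hlim
  exact ae_eq_of_lpDist_eq_zero hp
    ((aestronglyMeasurable_condExpβ hp hβ (hℬ k) ((hφ.1 _).mono (hℬ _))).mono (hℬ k))
    ((hφ.1 k).1.mono (hℬ k)) (tendsto_nhds_unique tendsto_const_nhds hlim)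

theorem IsFilteredMartingale.iteratedCondExpβ_ae_eq (hp : 0 < p)
    (hβ : IsContractiveBarycentricMap p β) (hℬ : ∀ n, ℬ n ≤ mΩ) (hmono : Monotone ℬ)
    (hφ : IsFilteredMartingale β P ℬ φ) (k j : ℕ) :
    iteratedCondExpβ β P ℬ (φ (k + j + 1)) k j =ᵐ[P] φ k := by
  induction j generalizing k with
  | zero => exact hφ.condExpβ_succ_ae_eq hp hβ hℬ hmono k
  | succ j ih =>
    have hih := ih (k + 1)
    rw [Nat.succ_add_eq_add_succ] at hih
    exact (condExpβ_congr_ae (hℬ k) hih).trans (hφ.condExpβ_succ_ae_eq hp hβ hℬ hmono k)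

theorem IsFilteredMartingale.isFilteredCondExp_of_tendsto (hp : 0 < p)
    (hβ : IsContractiveBarycentricMap p β) (hℬ : ∀ n, ℬ n ≤ mΩ) (hmono : Monotone ℬ)
    (hφ : IsFilteredMartingale β P ℬ φ) (hψ : MemLpOn p P mΩ ψ)
    (hlim : Tendsto (fun k ↦ lpDist p P (φ k) ψ) atTop (𝓝 0)) (k : ℕ) :
    IsFilteredCondExp β P ℬ k ψ (φ k) := by
  refine ⟨hφ.1 k, tendsto_of_tendsto_of_tendsto_of_le_of_le tendsto_const_nhds
    (hlim.comp (tendsto_atTop_mono (fun j ↦ show j ≤ k + j + 1 by lia) tendsto_id))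
    (fun _ ↦ zero_le) fun j ↦ ?_⟩
  calc lpDist p P (iteratedCondExpβ β P ℬ ψ k j) (φ k)
      = lpDist p P (iteratedCondExpβ β P ℬ ψ k j)
          (iteratedCondExpβ β P ℬ (φ (k + j + 1)) k j) :=
        lpDist_congr_ae .rfl (hφ.iteratedCondExpβ_ae_eq hp hβ hℬ hmono k j).symm
    _ ≤ lpDist p P ψ (φ (k + j + 1)) :=
        lpDist_iteratedCondExpβ_le hp hβ hℬ hψ ((hφ.1 _).mono (hℬ _)) k j
    _ = lpDist p P (φ (k + j + 1)) ψ := lpDist_comm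

end Martingale

end BetaMartingale

theorem theorem3p6_general {Ω M : Type*} {mΩ : MeasurableSpace Ω} [StandardBorelSpace Ω]
    [MetricSpace M] [MeasurableSpace M] [BorelSpace M] (P : Measure Ω) [IsFiniteMeasure P]
    (p : ℝ) (hp : 1 ≤ p) (β : BetaMartingale.WassersteinSpace M p → M)
    (hβ : BetaMartingale.IsContractiveBarycentricMap p β)
    (ℬ : ℕ → MeasurableSpace Ω) (hℬ : ∀ n, ℬ n ≤ mΩ) (hmono : Monotone ℬ)
    (φ : ℕ → Ω → M) (hφ : BetaMartingale.IsFilteredMartingale β P ℬ φ) :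
    (∃ ψ : Ω → M, BetaMartingale.MemLpOn p P mΩ ψ ∧
      ∀ k, BetaMartingale.IsFilteredCondExp β P ℬ k ψ (φ k)) ↔
    (∃ φ_lim : Ω → M, BetaMartingale.MemLpOn p P (⨆ n, ℬ n) φ_lim ∧
      Tendsto (fun k ↦ BetaMartingale.lpDist p P (φ k) φ_lim) atTop (𝓝 0)) := by
  have hp0 : 0 < p := zero_lt_one.trans_le hp
  have hsup : ⨆ n, ℬ n ≤ mΩ := iSup_le hℬ
  constructor
  · rintro ⟨ψ, hψ, hclosed⟩
    exact ⟨BetaMartingale.condExpβ (⨆ n, ℬ n) β P ψ,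
      BetaMartingale.memLpOn_condExpβ hp0 hβ hsup hψ,
      BetaMartingale.tendsto_lpDist_of_isFilteredCondExp hp hβ hℬ hmono hψ hclosed⟩
  · rintro ⟨φ_lim, hmem, hlim⟩
    exact ⟨φ_lim, hmem.mono hsup,
      hφ.isFilteredCondExp_of_tendsto hp0 hβ hℬ hmono (hmem.mono hsup) hlim⟩

theorem theorem3p6 {Ω M : Type*} {mΩ : MeasurableSpace Ω} [StandardBorelSpace Ω]
    [MetricSpace M] [CompleteSpace M] [MeasurableSpace M] [BorelSpace M]
    (P : Measure Ω) [IsProbabilityMeasure P]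
    (p : ℝ) (hp : 1 ≤ p)
    (β : BetaMartingale.WassersteinSpace M p → M)
    (hβ : BetaMartingale.IsContractiveBarycentricMap p β)
    (ℬ : ℕ → MeasurableSpace Ω) (hℬ : ∀ n, ℬ n ≤ mΩ) (hmono : Monotone ℬ)
    (φ : ℕ → Ω → M) (hφ : BetaMartingale.IsFilteredMartingale β P ℬ φ) :
    (∃ ψ : Ω → M, BetaMartingale.MemLpOn p P mΩ ψ ∧
      ∀ k, BetaMartingale.IsFilteredCondExp β P ℬ k ψ (φ k)) ↔
    (∃ φ_lim : Ω → M, BetaMartingale.MemLpOn p P (⨆ n, ℬ n) φ_lim ∧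
      Tendsto (fun k ↦ BetaMartingale.lpDist p P (φ k) φ_lim) atTop (𝓝 0)) :=
  theorem3p6_general P p hp β hβ ℬ hℬ hmono φ hφ
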